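/- Let $(X,d)$ be a nonempty complete metric space and let $\mathbb K(X)$ be the set of nonempty compact subsets of $X$ with the Hausdorff metric. For a metric space $Y$, $\ell_\infty(Y)$ is the set of bounded sequences $(y_k)_{k\ge 0}$ in $Y$. For $q\in(0,1]$ put $d_{s,q}(x,y)=\sup_k q^k d(x_k,y_k)$, and for $q\in(0,1)$, $p\in[1,\infty)$ put $d_{p,q}(x,y)=\big(\sum_k q^k d(x_k,y_k)^p\big)^{1/p}$. Let $n\ge 1$, let $\mathcal F=\{f_1,\dots,f_n\}$ be maps $\ell_\infty(X)\to X$, and let $L_{(s,q)}(\mathcal F)$, $L_{(p,q)}(\mathcal F)\in[0,\infty]$ be the largest of the Lipschitz constants of the $f_j$ with respect to $d_{s,q}$, $d_{p,q}$. Consider the conditions - $(S_1)$: $L_{(s,1)}(\mathcal F)<1$ and $\overline{f_j(\prod_k K_k)}\in\mathbb K(X)$ for all $j$ and all $(K_k)\in\ell_\infty(\mathbb K(X))$; - $(S_2)$: $L_{(s,1)}(\mathcal F)<1$ and $f_j(\prod_k K_k)\in\mathbb K(X)$ for all $j$ and all $(K_k)\in\ell_\infty(\mathbb K(X))$; - $(Q)$: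 $L_{(s,q)}(\mathcal F)<1$ for some $q\in(0,1)$; - $(P)$: $L_{(p,q)}(\mathcal F)<(1-q)^{1/p}$ for some $q\in(0,1)$, $p\in[1,\infty)$. For a set $Y$ let $Y_0=Y$ and $Y_{k+1}=Y_k\times Y_k\times\cdots$. With $\Omega=\{1,\dots,n\}$, let ${}_k\Omega=\Omega_0\times\dots\times\Omega_k$ and $\mathbf\Omega=\prod_{k=0}^\infty\Omega_k$. For $\alpha=(\alpha_0,\dots,\alpha_{k+1})\in{}_{k+1}\Omega$ and $i\ge 0$ let $\alpha(i)=(\alpha_1^{(i)},\dots,\alpha_{k+1}^{(i)})\in{}_k\Omega$, where $x^{(i)}$ is the $i$-th term of the sequence $x$. Put $f_{(j)}=f_j$ and $f_\alpha(x_0,x_1,\dots)=f_{\alpha_0}\big(f_{\alpha(0)}(x_0),f_{\alpha(1)}(x_1),\dots\big)$. On $\Omega_0$ let $d_{0,s,q}=d_{0,p,q}$ be the discrete metric, and on $\Omega_{k+1}$ let $$d_{k+1,s,q}(x,y)=\sup_i q^i d_{k,s,q}(x_i,y_i),\qquad d_{k+1,p,q}(x,y)=\Big(\sum_i q^i d_{k,p,q}(x_i,y_i)^p\Big)^{1/p}.$$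 On $\mathbf\Omega$ define, for $q\in(0,1)$ and $p\in[1,\infty)$, $$d_{(s,q)}(\alpha,\beta)=\sup_k q^k d_{k,s,q}(\alpha_k,\beta_k),\qquad d_{(p,q)}(\alpha,\beta)=\Big(\sum_k \big(\tfrac{1-q}{2}\big)^k d_{k,p,q}(\alpha_k,\beta_k)^p\Big)^{1/p}.$$ **Theorem.** Assume $(S_1)$. There is a unique $A_{\mathcal F}\in\mathbb K(X)$ with $A_{\mathcal F}=\bigcup_{j=1}^n\overline{f_j(A_{\mathcal F}\times A_{\mathcal F}\times\cdots)}$. With $A=A_{\mathcal F}$ and $A_\alpha=\overline{f_\alpha(A_{k+1})}$ for $\alpha\in{}_k\Omega$, for each $\alpha\in\mathbf\Omega$ the intersection $\bigcap_{k\ge 0}A_{\alpha|_k}$, where $\alpha|_k=(\alpha_0,\dots,\alpha_k)$, is a single point $\pi(\alpha)$. The map $\pi:\mathbf\Omega\to X$ satisfies: (i) $\overline{\pi(\mathbf\Omega)}=A_{\mathcal F}$. (ii) If $(S_2)$ holds, then $\pi(\mathbf\Omega)=A_{\mathcal F}$. (iii) $\pi$ is continuous for the product topology on $\mathbf\Omega$,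 each $\Omega_k$ being discrete. (iv) If $(Q)$ or $(P)$ holds, then $\pi$ is continuous for each of the metrics $d_{(s,q)}$ and $d_{(p,q)}$ on $\mathbf\Omega$, $q\in(0,1)$, $p\in[1,\infty)$. -/

import Mathlib

open Set TopologicalSpace
open scoped ENNReal NNReal

noncomputable section

/-- `Y_0 = Y`, `Y_{k+1} = Y_k × Y_k × ⋯`. -/
def Nested (Y : Type*) : ℕ → Type _
  | 0 => Y
  | k + 1 => ℕ → Nested Y k

/-- For `D ⊆ Y`, the subset `D_k` of `Y_k` : `D_0 = D`, `D_{k+1} = D_k × D_k × ⋯`. -/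
def nestedSet {Y : Type*} (D : Set Y) : (k : ℕ) → Set (Nested Y k)
  | 0 => D
  | k + 1 => {x : ℕ → Nested Y k | ∀ i, x i ∈ nestedSet D k}

/-- `sup_i q^i ρ(x_i, y_i)` -/
def supDist (q : ℝ) {Y : Type*} (ρ : Y → Y → ℝ) (x y : ℕ → Y) : ℝ :=
  ⨆ i : ℕ, q ^ i * ρ (x i) (y i)

/-- `(∑_i q^i ρ(x_i, y_i)^p)^{1/p}` -/
def lpDist (p q : ℝ) {Y : Type*} (ρ : Y → Y → ℝ) (x y : ℕ → Y) : ℝ :=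
  (∑' i : ℕ, q ^ i * ρ (x i) (y i) ^ p) ^ (1 / p)

section Systems

variable {X : Type*} [MetricSpace X]

/-- `ℓ_∞(X)`: the bounded sequences of points of `X`. -/
def EllInfty (X : Type*) [MetricSpace X] : Type _ :=
  {x : ℕ → X // Bornology.IsBounded (range x)}

/-- The Lipschitz constant in `[0, ∞]` of a map `ℓ_∞(X) → X`, with respect to the distance `ρ` on
sequences and the metric of `X`. -/
def lipConst (ρ : (ℕ → X) → (ℕ → X) → ℝ) (f : EllInfty X → X) : ℝ≥0∞ :=
  ⨅ (K : ℝ≥0) (_ : ∀ x y : EllInfty X, dist (f x) (f y) ≤ K * ρ x.1 y.1), (K : ℝ≥0∞)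

/-- `L_{(s,q)}(f_1, …, f_n)`: the largest Lipschitz constant with respect to `d_{s,q}`. -/
def lipS (q : ℝ) {n : ℕ} (f : Fin n → EllInfty X → X) : ℝ≥0∞ :=
  ⨆ j, lipConst (supDist q dist) (f j)

/-- `L_{(p,q)}(f_1, …, f_n)`: the largest Lipschitz constant with respect to `d_{p,q}`. -/
def lipP (p q : ℝ) {n : ℕ} (f : Fin n → EllInfty X → X) : ℝ≥0∞ :=
  ⨆ j, lipConst (lpDist p q dist) (f j)

/-- The product `K_0 × K_1 × ⋯`, as a subset of `ℓ_∞(X)`. -/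
def prodSet (K : ℕ → Set X) : Set (EllInfty X) := {x | ∀ i, x.1 i ∈ K i}

/-- (C1): the closure of `f(∏ K_k)` is a nonempty compact set, for each sequence `(K_k)` of
nonempty compact sets that is bounded in the Hausdorff metric. -/
def CondC1 (f : EllInfty X → X) : Prop :=
  ∀ K : EllInfty (NonemptyCompacts X),
    (closure (f '' prodSet fun i => (K.1 i : Set X))).Nonempty ∧
      IsCompact (closure (f '' prodSet fun i => (K.1 i : Set X)))

/-- (C2): the same for `f(∏ K_k)` itself. -/
def CondC2 (f : EllInfty X → X) : Prop :=
  ∀ K : EllInfty (NonemptyCompacts X),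
    (f '' prodSet fun i => (K.1 i : Set X)).Nonempty ∧
      IsCompact (f '' prodSet fun i => (K.1 i : Set X))

def CondS1 {n : ℕ} (f : Fin n → EllInfty X → X) : Prop :=
  lipS 1 f < 1 ∧ ∀ j, CondC1 (f j)

def CondS2 {n : ℕ} (f : Fin n → EllInfty X → X) : Prop :=
  lipS 1 f < 1 ∧ ∀ j, CondC2 (f j)

def CondQ {n : ℕ} (f : Fin n → EllInfty X → X) : Prop :=
  ∃ q : ℝ, 0 < q ∧ q < 1 ∧ lipS q f < 1

def CondP {n : ℕ} (f : Fin n → EllInfty X → X) : Prop :=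
  ∃ p q : ℝ, 1 ≤ p ∧ 0 < q ∧ q < 1 ∧ lipP p q f < ENNReal.ofReal ((1 - q) ^ (1 / p))

/-- `𝓕(K_0, K_1, …)`: the union of the closures of the sets `f_j(K_0 × K_1 × ⋯)`. -/
def hutchinson {n : ℕ} (f : Fin n → EllInfty X → X) (K : ℕ → Set X) : Set X :=
  ⋃ j, closure (f j '' prodSet K)

/-- `A` is an attractor (fractal) of the system: `𝓕(A, A, …) = A`. -/
def IsAttractor {n : ℕ} (f : Fin n → EllInfty X → X) (A : NonemptyCompacts X) : Prop :=
  hutchinson f (fun _ => (A : Set X)) = A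

end Systems

/-- The finite words `(α_0, …, α_k)` with `α_i ∈ Ω_i`, where `Ω = {1, …, n}`. -/
def Word (n k : ℕ) : Type := (i : Fin (k + 1)) → Nested (Fin n) i

/-- The code space `Ω_0 × Ω_1 × Ω_2 × ⋯`. -/
def CodeSpace (n : ℕ) : Type := (k : ℕ) → Nested (Fin n) k

/-- `α|_k = (α_0, …, α_k)` -/
def CodeSpace.restrict {n : ℕ} (α : CodeSpace n) (k : ℕ) : Word n k := fun i => α i

/-- The first letter `α_0 ∈ Ω_0 = {1, …, n}`. -/
def Word.head {n k : ℕ} (α : Word n k) : Fin n := α 0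

/-- `α(i) = (α_1^{(i)}, …, α_{k+1}^{(i)})`, where `x^{(i)}` is the `i`-th entry of the
sequence `x`. -/
def Word.slice {n k : ℕ} (α : Word n (k + 1)) (i : ℕ) : Word n k :=
  fun j => (α j.succ : ℕ → Nested (Fin n) j) i

section Pieces

variable {X : Type*} [MetricSpace X]

open Classical in
/-- A map on `ℓ_∞(X)` as a total function on sequences; the value at an unbounded sequence is
irrelevant. -/
def extend (g : EllInfty X → X) (x : ℕ → X) : X :=
  if h : Bornology.IsBounded (range x) then g ⟨x, h⟩ else x 0

/-- The generalized compositions: `f_{(j)} = f_j`, and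
`f_α(x_0, x_1, …) = f_{α_0}(f_{α(0)}(x_0), f_{α(1)}(x_1), …)`. The function `extend` never sees an
unbounded sequence when `x` is in `A_{k+1}` for an attractor `A`, see `codeMap_zero_of_mem` and
`codeMap_succ_of_mem`. -/
def codeMap {n : ℕ} (f : Fin n → EllInfty X → X) : (k : ℕ) → Word n k → Nested X (k + 1) → X
  | 0, α, x => extend (f α.head) x
  | k + 1, α, x => extend (f α.head) fun i => codeMap f k (α.slice i) (x i)

/-- The piece `A_α`, the closure of `f_α(A_{k+1})`. -/
def piece {n : ℕ} (f : Fin n → EllInfty X → X) (A : Set X) {k : ℕ} (α : Word n k) : Set X :=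
  closure (codeMap f k α '' nestedSet A (k + 1))

/-- `π(α)` is the unique point of `⋂_k A_{α|_k}`, for all `α` in the code space. -/
def IsCanonicalMap {n : ℕ} (f : Fin n → EllInfty X → X) (A : Set X) (π : CodeSpace n → X) :
    Prop :=
  ∀ α : CodeSpace n, ⋂ k : ℕ, piece f A (α.restrict k) = {π α}

theorem isBounded_range_of_forall_mem {A : NonemptyCompacts X} {y : ℕ → X} (h : ∀ i, y i ∈ A) :
    Bornology.IsBounded (range y) :=
  A.isCompact.isBounded.subset (range_subset_iff.2 h)

theorem IsAttractor.apply_mem {n : ℕ} {f : Fin n → EllInfty X → X} {A : NonemptyCompacts X}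
    (hA : IsAttractor f A) (j : Fin n) (x : EllInfty X) (hx : ∀ i, x.1 i ∈ A) : f j x ∈ A := by
  have : f j x ∈ hutchinson f (fun _ => (A : Set X)) :=
    mem_iUnion.2 ⟨j, subset_closure ⟨x, hx, rfl⟩⟩
  rw [hA] at this
  exact this

theorem extend_mem {n : ℕ} {f : Fin n → EllInfty X → X} {A : NonemptyCompacts X}
    (hA : IsAttractor f A) (j : Fin n) (y : ℕ → X) (hy : ∀ i, y i ∈ A) : extend (f j) y ∈ A := by
  have hb := isBounded_range_of_forall_mem hy
  unfold extend
  rw [dif_pos hb]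
  exact hA.apply_mem j ⟨y, hb⟩ hy

theorem codeMap_mem {n : ℕ} {f : Fin n → EllInfty X → X} {A : NonemptyCompacts X}
    (hA : IsAttractor f A) (k : ℕ) (α : Word n k) (x : Nested X (k + 1))
    (hx : x ∈ nestedSet (A : Set X) (k + 1)) : codeMap f k α x ∈ A := by
  induction k with
  | zero => exact extend_mem hA _ _ hx
  | succ k ih => exact extend_mem hA _ _ fun i => ih _ _ (hx i)

theorem codeMap_zero_of_mem {n : ℕ} {f : Fin n → EllInfty X → X} {A : NonemptyCompacts X}
    (α : Word n 0) (x : ℕ → X) (hx : ∀ i, x i ∈ A) :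
    codeMap f 0 α x = f α.head ⟨x, isBounded_range_of_forall_mem hx⟩ :=
  dif_pos (isBounded_range_of_forall_mem hx)

theorem codeMap_succ_of_mem {n : ℕ} {f : Fin n → EllInfty X → X} {A : NonemptyCompacts X}
    (hA : IsAttractor f A) {k : ℕ} (α : Word n (k + 1)) (x : ℕ → Nested X (k + 1))
    (hx : ∀ i, x i ∈ nestedSet (A : Set X) (k + 1)) :
    codeMap f (k + 1) α x = f α.head ⟨fun i => codeMap f k (α.slice i) (x i),
      isBounded_range_of_forall_mem fun i => codeMap_mem hA k _ _ (hx i)⟩ :=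
  dif_pos (isBounded_range_of_forall_mem fun i => codeMap_mem hA k _ _ (hx i))

end Pieces

/-- The discrete metric on `{1, …, n}`. -/
def discreteDist {n : ℕ} (i j : Fin n) : ℝ := if i = j then 0 else 1

/-- `d_{k,s,q}` on `Ω_k` -/
def nestedDistS (q : ℝ) {n : ℕ} : (k : ℕ) → Nested (Fin n) k → Nested (Fin n) k → ℝ
  | 0 => discreteDist
  | k + 1 => supDist q (nestedDistS q k)

/-- `d_{k,p,q}` on `Ω_k` -/
def nestedDistP (p q : ℝ) {n : ℕ} : (k : ℕ) → Nested (Fin n) k → Nested (Fin n) k → ℝ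
  | 0 => discreteDist
  | k + 1 => lpDist p q (nestedDistP p q k)

/-- `d_{(s,q)}` on the code space -/
def codeDistS (q : ℝ) {n : ℕ} (α β : CodeSpace n) : ℝ :=
  ⨆ k : ℕ, q ^ k * nestedDistS q k (α k) (β k)

/-- `d_{(p,q)}` on the code space -/
def codeDistP (p q : ℝ) {n : ℕ} (α β : CodeSpace n) : ℝ :=
  (∑' k : ℕ, ((1 - q) / 2) ^ k * nestedDistP p q k (α k) (β k) ^ p) ^ (1 / p)

/-- Continuity of a map into a metric space, for the metric `ρ` on its domain. -/
def ContinuousForDist {Y X : Type*} [MetricSpace X] (ρ : Y → Y → ℝ) (g : Y → X) : Prop :=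
  ∀ a : Y, ∀ ε > 0, ∃ δ > 0, ∀ b : Y, ρ a b < δ → dist (g a) (g b) < ε

/-- The product topology on the code space, each `Ω_k` being discrete. -/
abbrev discreteProductTopology (n : ℕ) : TopologicalSpace (CodeSpace n) :=
  @Pi.topologicalSpace ℕ (fun k => Nested (Fin n) k) fun _ => ⊥

end

/-! Under (S_1) one factor L < 1 contracts the uniform distance for every f_j. The Hutchinson
operator is then an L-contraction of the complete space 𝕂(X), and Banach's theorem gives the
attractor A. Each layer of a generalized composition contributes a factor L, so the pieces along a
code decrease and have diameter at most L^(k+1) diam A; Cantor's intersection theorem yields π.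
Codes sharing a long initial word have images in one small piece, which is (iii).

The self-similarity π(α) = f_{α_0}(π(α(0)), π(α(1)), …), proved in `IsCanonicalMap.apply_eq_extend`,
makes the closure of π(𝛀) an attractor, hence equal to A. Under (S_2) the images are closed, so
every point of A has exact preimages in A; choosing them repeatedly writes down a code of the point.

For (iv), small weighted distance forces agreement only at finitely many positions inside each
nested sequence. Under (Q) or (P) the f_j depend little on the tails of sequences in A
(`TailContinuous`), and unrolling the self-similarity shows that such agreement suffices
(`IsCanonicalMap.exists_agreeBelow_dist_lt`). -/

noncomputable section

/-! ### The Hutchinson operator and its fixed point. -/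

section Systems

variable {X : Type*} [MetricSpace X] {n : ℕ} {f : Fin n → EllInfty X → X}

/-- Each `f j` contracts the uniform distance of sequences by the factor `L`. -/
def ContractsUniformly (f : Fin n → EllInfty X → X) (L : ℝ≥0) : Prop :=
  ∀ j (x y : EllInfty X) (r : ℝ), (∀ i, dist (x.1 i) (y.1 i) ≤ r) →
    dist (f j x) (f j y) ≤ L * r

theorem exists_lt_of_lipConst_lt {ρ : (ℕ → X) → (ℕ → X) → ℝ} {g : EllInfty X → X} {c : ℝ≥0∞}
    (h : lipConst ρ g < c) :
    ∃ K : ℝ≥0, (K : ℝ≥0∞) < c ∧ ∀ x y : EllInfty X, dist (g x) (g y) ≤ K * ρ x.1 y.1 := by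
  unfold lipConst at h
  obtain ⟨K, hK⟩ := iInf_lt_iff.1 h
  obtain ⟨hg, hK⟩ := iInf_lt_iff.1 hK
  exact ⟨K, hK, hg⟩

/-- The strict inequality leaves room for one real factor that serves all j, although the infimum
`lipConst` need not be attained. -/
theorem exists_contractsUniformly (h : lipS 1 f < 1) :
    ∃ L : ℝ≥0, L < 1 ∧ ContractsUniformly f L := by
  obtain ⟨L, hfL, hL⟩ := ENNReal.lt_iff_exists_nnreal_btwn.1 h
  refine ⟨L, by exact_mod_cast hL, fun j x y r hr => ?_⟩
  obtain ⟨K, hK, hg⟩ := exists_lt_of_lipConst_lt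
    ((le_iSup (fun j => lipConst (supDist 1 dist) (f j)) j).trans_lt hfL)
  have hKL : (K : ℝ) ≤ L := by
    have : K < L := by exact_mod_cast hK
    exact_mod_cast this.le
  have hs : supDist 1 dist x.1 y.1 ≤ r := ciSup_le fun i => by simpa using hr i
  have hr0 : 0 ≤ r := dist_nonneg.trans (hr 0)
  calc dist (f j x) (f j y) ≤ K * supDist 1 dist x.1 y.1 := hg x y
    _ ≤ K * r := by gcongr
    _ ≤ L * r := by gcongr

theorem hutchinson_eq_closure (f : Fin n → EllInfty X → X) (K : ℕ → Set X) :
    hutchinson f K = closure (⋃ j, f j '' prodSet K) :=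
  (closure_iUnion_of_finite _).symm

/-- The Hutchinson operator on nonempty compact sets. -/
def hutchinsonMap (hn : 0 < n) (hC : ∀ j, CondC1 (f j)) (A : NonemptyCompacts X) :
    NonemptyCompacts X where
  carrier := hutchinson f fun _ => (A : Set X)
  isCompact' := isCompact_iUnion fun j => (hC j ⟨fun _ => A, by simp⟩).2
  nonempty' := by
    obtain ⟨x, hx⟩ := (hC ⟨0, hn⟩ ⟨fun _ => A, by simp⟩).1
    exact ⟨x, mem_iUnion.2 ⟨_, hx⟩⟩

theorem exists_dist_le_hausdorffDist (A B : NonemptyCompacts X) {a : X} (ha : a ∈ A) :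
    ∃ b ∈ B, dist a b ≤ dist A B := by
  obtain ⟨b, hb, hab⟩ := B.isCompact.exists_infDist_eq_dist B.nonempty a
  refine ⟨b, hb, hab ▸ ?_⟩
  rw [Metric.NonemptyCompacts.dist_eq]
  exact Metric.infDist_le_hausdorffDist_of_mem ha
    (Metric.hausdorffEDist_ne_top_of_nonempty_of_bounded A.nonempty B.nonempty
      A.isCompact.isBounded B.isCompact.isBounded)

theorem ContractsUniformly.exists_dist_le {L : ℝ≥0} (hL : ContractsUniformly f L)
    (A B : NonemptyCompacts X) {x : X} (hx : x ∈ ⋃ j, f j '' prodSet fun _ => (A : Set X)) :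
    ∃ y ∈ ⋃ j, f j '' prodSet fun _ => (B : Set X), dist x y ≤ L * dist A B := by
  obtain ⟨j, a, ha, rfl⟩ := mem_iUnion.1 hx
  choose b hb hab using fun i => exists_dist_le_hausdorffDist A B (ha i)
  exact ⟨_, mem_iUnion.2 ⟨j, mem_image_of_mem _
    (show (⟨b, isBounded_range_of_forall_mem hb⟩ : EllInfty X) ∈ prodSet _ from hb)⟩,
    hL j _ _ _ hab⟩

/-- The Hausdorff distance ignores closures, so only the images themselves are compared, by
replacing each entry of a sequence with a nearest point of the other compact set. -/
theorem ContractsUniformly.contractingWith_hutchinsonMap {L : ℝ≥0}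
    (hL : ContractsUniformly f L) (hL1 : L < 1) (hn : 0 < n) (hC : ∀ j, CondC1 (f j)) :
    ContractingWith L (hutchinsonMap hn hC) := by
  refine ⟨hL1, LipschitzWith.of_dist_le_mul fun A B => ?_⟩
  rw [Metric.NonemptyCompacts.dist_eq]
  change Metric.hausdorffDist (hutchinson f _) (hutchinson f _) ≤ _
  rw [hutchinson_eq_closure, hutchinson_eq_closure, Metric.hausdorffDist_closure]
  refine Metric.hausdorffDist_le_of_mem_dist (by positivity)
    (fun x hx => hL.exists_dist_le A B hx) fun x hx => ?_
  rw [dist_comm A B]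
  exact hL.exists_dist_le B A hx

theorem isAttractor_iff_isFixedPt (hn : 0 < n) (hC : ∀ j, CondC1 (f j))
    (A : NonemptyCompacts X) :
    IsAttractor f A ↔ Function.IsFixedPt (hutchinsonMap hn hC) A :=
  ⟨fun h => NonemptyCompacts.ext h, fun h => congrArg ((↑) : NonemptyCompacts X → Set X) h⟩

theorem ContractsUniformly.existsUnique_isAttractor [CompleteSpace X] [Nonempty X] {L : ℝ≥0}
    (hL : ContractsUniformly f L) (hL1 : L < 1) (hn : 0 < n) (hC : ∀ j, CondC1 (f j)) :
    ∃! A : NonemptyCompacts X, IsAttractor f A := by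
  have hF := hL.contractingWith_hutchinsonMap hL1 hn hC
  refine ⟨hF.fixedPoint, (isAttractor_iff_isFixedPt hn hC _).2 hF.fixedPoint_isFixedPt,
    fun B hB => hF.fixedPoint_unique ((isAttractor_iff_isFixedPt hn hC _).1 hB)⟩

end Systems

/-! ### Pieces, the canonical map, its range and its continuity for the product topology. -/

namespace CodeSpace

/-- `α(i) = (α_1^{(i)}, α_2^{(i)}, …)` -/
def slice {n : ℕ} (α : CodeSpace n) (i : ℕ) : CodeSpace n :=
  fun k => (α (k + 1) : ℕ → Nested (Fin n) k) i

/-- The code with first letter `j` and slices `β i`. -/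
def cons {n : ℕ} (j : Fin n) (β : ℕ → CodeSpace n) : CodeSpace n
  | 0 => j
  | k + 1 => fun i => β i k

end CodeSpace

section Pieces

variable {X : Type*} [MetricSpace X] {n : ℕ} {f : Fin n → EllInfty X → X}
  {A : NonemptyCompacts X} {L : ℝ≥0}

theorem ContractsUniformly.dist_extend_le (hL : ContractsUniformly f L) (j : Fin n)
    {x y : ℕ → X} (hx : ∀ i, x i ∈ A) (hy : ∀ i, y i ∈ A) {r : ℝ}
    (hr : ∀ i, dist (x i) (y i) ≤ r) : dist (extend (f j) x) (extend (f j) y) ≤ L * r := by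
  unfold extend
  rw [dif_pos (isBounded_range_of_forall_mem hx), dif_pos (isBounded_range_of_forall_mem hy)]
  exact hL j _ _ r hr

theorem nestedSet_nonempty {Y : Type*} {D : Set Y} (hD : D.Nonempty) :
    ∀ k, (nestedSet D k).Nonempty
  | 0 => hD
  | k + 1 => by
    obtain ⟨x, hx⟩ := nestedSet_nonempty hD k
    exact ⟨fun _ => x, fun _ => hx⟩

theorem ContractsUniformly.dist_codeMap_le (hL : ContractsUniformly f L) (hA : IsAttractor f A) :
    ∀ (k : ℕ) (α : Word n k) (x y : Nested X (k + 1)), x ∈ nestedSet (A : Set X) (k + 1) →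
      y ∈ nestedSet (A : Set X) (k + 1) →
      dist (codeMap f k α x) (codeMap f k α y) ≤ L ^ (k + 1) * Metric.diam (A : Set X)
  | 0, α, x, y, hx, hy => by
    rw [zero_add, pow_one]
    exact hL.dist_extend_le _ hx hy fun i =>
      Metric.dist_le_diam_of_mem (α := X) A.isCompact.isBounded (hx i) (hy i)
  | k + 1, α, x, y, hx, hy => by
    rw [pow_succ' _ (k + 1), mul_assoc]
    exact hL.dist_extend_le (A := A) _ (fun i => codeMap_mem hA k _ _ (hx i))
      (fun i => codeMap_mem hA k _ _ (hy i))
      fun i => hL.dist_codeMap_le hA k (α.slice i) (x i) (y i) (hx i) (hy i)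

theorem ContractsUniformly.dist_le_of_mem_piece (hL : ContractsUniformly f L)
    (hA : IsAttractor f A) {k : ℕ} {α : Word n k} {x y : X} (hx : x ∈ piece f A α)
    (hy : y ∈ piece f A α) : dist x y ≤ L ^ (k + 1) * Metric.diam (A : Set X) := by
  have hsub : codeMap f k α '' nestedSet (A : Set X) (k + 1) ⊆ A := by
    rintro _ ⟨x, hx, rfl⟩
    exact codeMap_mem hA k α x hx
  refine (Metric.dist_le_diam_of_mem (A.isCompact.isBounded.subset hsub).closure hx hy).trans ?_
  rw [Metric.diam_closure]
  refine Metric.diam_le_of_forall_dist_le (by positivity) ?_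
  rintro _ ⟨x, hx, rfl⟩ _ ⟨y, hy, rfl⟩
  exact hL.dist_codeMap_le hA k α x y hx hy

theorem piece_subset (hA : IsAttractor f A) {k : ℕ} (α : Word n k) : piece f A α ⊆ A := by
  refine closure_minimal ?_ A.isCompact.isClosed
  rintro _ ⟨x, hx, rfl⟩
  exact codeMap_mem hA k α x hx

theorem exists_codeMap_restrict_eq (hA : IsAttractor f A) :
    ∀ (k : ℕ) (α : CodeSpace n) (x : Nested X (k + 2)), x ∈ nestedSet (A : Set X) (k + 2) →
      ∃ y ∈ nestedSet (A : Set X) (k + 1),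
        codeMap f k (α.restrict k) y = codeMap f (k + 1) (α.restrict (k + 1)) x
  | 0, α, x, hx => ⟨fun i => codeMap (X := X) f 0 ((α.restrict 1).slice i) (x i),
      fun i => codeMap_mem hA 0 _ _ (hx i), rfl⟩
  | k + 1, α, x, hx => by
    choose y hy hxy using fun i => exists_codeMap_restrict_eq hA k (α.slice i) (x i) (hx i)
    exact ⟨y, hy, congrArg (extend (f (α 0))) (funext hxy)⟩

theorem piece_restrict_succ_subset (hA : IsAttractor f A) (α : CodeSpace n) (k : ℕ) :
    piece f A (α.restrict (k + 1)) ⊆ piece f A (α.restrict k) := by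
  refine closure_mono ?_
  rintro _ ⟨x, hx, rfl⟩
  exact exists_codeMap_restrict_eq hA k α x hx

theorem tendsto_pow_succ_mul (hL1 : L < 1) (D : ℝ) :
    Filter.Tendsto (fun k : ℕ => (L : ℝ) ^ (k + 1) * D) Filter.atTop (nhds 0) := by
  have h := (tendsto_pow_atTop_nhds_zero_of_lt_one L.coe_nonneg
    (by exact_mod_cast hL1 : (L : ℝ) < 1)).comp (Filter.tendsto_add_atTop_nat 1)
  simpa using h.mul_const D

theorem ContractsUniformly.exists_isCanonicalMap (hL : ContractsUniformly f L) (hL1 : L < 1)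
    (hA : IsAttractor f A) : ∃ π : CodeSpace n → X, IsCanonicalMap f A π := by
  have hne : ∀ α : CodeSpace n, (⋂ k, piece f A (α.restrict k)).Nonempty := fun α =>
    IsCompact.nonempty_iInter_of_sequence_nonempty_isCompact_isClosed
      (fun k => piece f A (α.restrict k)) (piece_restrict_succ_subset hA α)
      (fun k => ((nestedSet_nonempty A.nonempty (k + 1)).image _).closure)
      (A.isCompact.of_isClosed_subset isClosed_closure (piece_subset hA _))
      fun k => isClosed_closure
  choose π hπ using hne
  refine ⟨π, fun α => Subset.antisymm (fun x hx => ?_) (singleton_subset_iff.2 (hπ α))⟩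
  refine dist_le_zero.1 (ge_of_tendsto'
    (tendsto_pow_succ_mul hL1 (Metric.diam (A : Set X))) fun k => ?_)
  exact hL.dist_le_of_mem_piece hA (mem_iInter.1 hx k) (mem_iInter.1 (hπ α) k)

variable {π : CodeSpace n → X}

theorem IsCanonicalMap.mem_piece (hπ : IsCanonicalMap f A π) (α : CodeSpace n) (k : ℕ) :
    π α ∈ piece f A (α.restrict k) :=
  mem_iInter.1 ((hπ α).symm ▸ mem_singleton (π α)) k

theorem IsCanonicalMap.eq_of_forall_mem_piece (hπ : IsCanonicalMap f A π) {α : CodeSpace n}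
    {x : X} (h : ∀ k, x ∈ piece f A (α.restrict k)) : x = π α := by
  have hx := mem_iInter.2 h
  rwa [hπ α] at hx

theorem IsCanonicalMap.apply_mem (hπ : IsCanonicalMap f A π) (hA : IsAttractor f A)
    (α : CodeSpace n) : π α ∈ A :=
  piece_subset hA _ (hπ.mem_piece α 0)

/-- The right side lies in every piece of α: approximate all π(α(i)) at once, within ε/2, by values
of the word maps. Applying f_{α_0} keeps the error at most L ε/2 < ε. -/
theorem IsCanonicalMap.apply_eq_extend (hπ : IsCanonicalMap f A π)
    (hL : ContractsUniformly f L) (hL1 : L < 1) (hA : IsAttractor f A) (α : CodeSpace n) :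
    π α = extend (f (α 0)) fun i => π (α.slice i) := by
  refine (hπ.eq_of_forall_mem_piece fun k => ?_).symm
  cases k with
  | zero => exact subset_closure ⟨_, fun i => hπ.apply_mem hA _, rfl⟩
  | succ k =>
    refine Metric.mem_closure_iff.2 fun ε hε => ?_
    have hclose : ∀ i, ∃ y ∈ nestedSet (A : Set X) (k + 1),
        dist (π (α.slice i)) (codeMap f k ((α.slice i).restrict k) y) ≤ ε / 2 := fun i => by
      obtain ⟨_, ⟨y, hy, rfl⟩, hd⟩ :=
        Metric.mem_closure_iff.1 (hπ.mem_piece (α.slice i) k) (ε / 2) (half_pos hε)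
      exact ⟨y, hy, hd.le⟩
    choose y hy hd using hclose
    refine ⟨codeMap f (k + 1) (α.restrict (k + 1)) y, mem_image_of_mem _ hy, ?_⟩
    have h := hL.dist_extend_le (A := A) (α 0) (fun i => hπ.apply_mem hA _)
      (fun i => codeMap_mem hA k ((α.slice i).restrict k) (y i) (hy i)) hd
    have hL1' : (L : ℝ) < 1 := by exact_mod_cast hL1
    refine h.trans_lt ?_
    nlinarith

theorem IsCanonicalMap.closure_range (hπ : IsCanonicalMap f A π) (hL : ContractsUniformly f L)
    (hL1 : L < 1) (hA : IsAttractor f A) (hn : 0 < n) (hC : ∀ j, CondC1 (f j)) :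
    closure (range π) = A := by
  have hsub : closure (range π) ⊆ A :=
    closure_minimal (range_subset_iff.2 (hπ.apply_mem hA)) A.isCompact.isClosed
  have hne : Nonempty (CodeSpace n) := by
    let c : ∀ k, Nested (Fin n) k := fun k => Nat.rec ⟨0, hn⟩ (fun _ x _ => x) k
    exact ⟨c⟩
  let B : NonemptyCompacts X :=
    ⟨⟨closure (range π), A.isCompact.of_isClosed_subset isClosed_closure hsub⟩,
      (range_nonempty π).closure⟩
  have hB : IsAttractor f B := by
    change hutchinson f (fun _ => closure (range π)) = closure (range π)
    rw [hutchinson_eq_closure]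
    refine Subset.antisymm (closure_minimal ?_ isClosed_closure) (closure_mono ?_)
    · refine iUnion_subset fun j => ?_
      rintro _ ⟨x, hx, rfl⟩
      refine Metric.mem_closure_iff.2 fun ε hε => ?_
      have hclose : ∀ i, ∃ α, dist (x.1 i) (π α) ≤ ε / 2 := fun i => by
        obtain ⟨_, ⟨α, rfl⟩, hd⟩ := Metric.mem_closure_iff.1 (hx i) (ε / 2) (half_pos hε)
        exact ⟨α, hd.le⟩
      choose β hβ using hclose
      refine ⟨_, mem_range_self (CodeSpace.cons j β), ?_⟩
      have hb : Bornology.IsBounded (range fun i => π (β i)) :=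
        isBounded_range_of_forall_mem fun i => hπ.apply_mem hA _
      have he : π (CodeSpace.cons j β) = f j ⟨fun i => π (β i), hb⟩ :=
        (hπ.apply_eq_extend hL hL1 hA _).trans (dif_pos hb)
      have hL1' : (L : ℝ) < 1 := by exact_mod_cast hL1
      rw [he]
      refine (hL j x ⟨_, hb⟩ _ hβ).trans_lt ?_
      nlinarith
    · rintro _ ⟨α, rfl⟩
      have hb : Bornology.IsBounded (range fun i => π (α.slice i)) :=
        isBounded_range_of_forall_mem fun i => hπ.apply_mem hA _
      rw [hπ.apply_eq_extend hL hL1 hA]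
      unfold extend
      rw [dif_pos hb]
      exact mem_iUnion.2 ⟨α 0, mem_image_of_mem _ fun i => subset_closure (mem_range_self _)⟩
  have hF := hL.contractingWith_hutchinsonMap hL1 hn hC
  -- Uniqueness of the attractor replaces any direct proof that the range is dense.
  have hBA : B = A := hF.fixedPoint_unique' ((isAttractor_iff_isFixedPt hn hC B).1 hB)
    ((isAttractor_iff_isFixedPt hn hC A).1 hA)
  exact congrArg ((↑) : NonemptyCompacts X → Set X) hBA

/-- The code of a point `a`, when `j` chooses a letter and `x` a sequence of preimages for each
point. -/
def itinerary {Y : Type*} (j : Y → Fin n) (x : Y → ℕ → Y) : Y → CodeSpace n :=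
  fun a k => Nat.rec (motive := fun k => Y → Nested (Fin n) k) j (fun _ c a i => c (x a i)) k a

theorem IsCanonicalMap.range_eq (hπ : IsCanonicalMap f A π) (hA : IsAttractor f A)
    (hC : ∀ j, CondC2 (f j)) : range π = A := by
  refine Subset.antisymm (range_subset_iff.2 (hπ.apply_mem hA)) fun a ha => ?_
  have hpre : ∀ a : A, ∃ (j : Fin n) (x : ℕ → A), extend (f j) (fun i => (x i : X)) = a := by
    rintro ⟨a, ha⟩
    have ha' : a ∈ hutchinson f fun _ => (A : Set X) := by
      rw [hA]
      exact ha
    obtain ⟨j, hj⟩ := mem_iUnion.1 ha'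
    -- Here (C2) turns a limit of values into an exact value.
    rw [(hC j ⟨fun _ => A, by simp⟩).2.isClosed.closure_eq] at hj
    obtain ⟨x, hx, rfl⟩ := hj
    exact ⟨j, fun i => ⟨x.1 i, hx i⟩, dif_pos x.2⟩
  choose j x hx using hpre
  have hmem : ∀ (k : ℕ) (a : A), ∃ y ∈ nestedSet (A : Set X) (k + 1),
      codeMap f k ((itinerary j x a).restrict k) y = a := by
    intro k
    induction k with
    | zero => exact fun a => ⟨fun i => (x a i : X), fun i => (x a i).2, hx a⟩
    | succ k ih =>
      intro a
      choose y hy hxy using fun i => ih (x a i)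
      exact ⟨y, hy, (congrArg (extend (f (j a))) (funext hxy)).trans (hx a)⟩
  exact ⟨itinerary j x ⟨a, ha⟩, (hπ.eq_of_forall_mem_piece fun k => subset_closure
    (hmem k ⟨a, ha⟩)).symm⟩

theorem IsCanonicalMap.continuous (hπ : IsCanonicalMap f A π) (hL : ContractsUniformly f L)
    (hL1 : L < 1) (hA : IsAttractor f A) :
    @Continuous (CodeSpace n) X (discreteProductTopology n) _ π := by
  let _ : ∀ k, TopologicalSpace (Nested (Fin n) k) := fun _ => ⊥
  let _ : TopologicalSpace (CodeSpace n) := discreteProductTopology n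
  have _ : ∀ k, DiscreteTopology (Nested (Fin n) k) := fun _ => ⟨rfl⟩
  refine Metric.continuous_iff'.2 fun α ε hε => ?_
  obtain ⟨k, hk⟩ := ((tendsto_pow_succ_mul hL1 (Metric.diam (A : Set X))).eventually
    (gt_mem_nhds hε)).exists
  have hev : ∀ i : Fin (k + 1), ∀ᶠ β : CodeSpace n in nhds α, β i = α i := fun i =>
    (continuous_apply (A := fun k => Nested (Fin n) k) (i : ℕ)).continuousAt.eventually
      (p := fun y => y = α i) ((isOpen_discrete {α i}).mem_nhds rfl)
  filter_upwards [Filter.eventually_all.2 hev] with β hβ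
  have hr : β.restrict k = α.restrict k := funext hβ
  exact (hL.dist_le_of_mem_piece hA (hr ▸ hπ.mem_piece β k) (hπ.mem_piece α k)).trans_lt hk

end Pieces

/-- The restrictions of two elements of `Ω_k` to indices less than `N` coincide. -/
def AgreeBelow (N : ℕ) {Y : Type*} : (k : ℕ) → Nested Y k → Nested Y k → Prop
  | 0 => fun x y => x = y
  | k + 1 => fun x y => ∀ i < N, AgreeBelow N k (x i) (y i)

/-! ### Dependence on finitely many positions. -/

section TailContinuity

variable {X : Type*} [MetricSpace X] {n : ℕ} {f : Fin n → EllInfty X → X}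
  {A : NonemptyCompacts X} {L : ℝ≥0} {π : CodeSpace n → X}

/-- The maps `f j` depend uniformly little on the tails of sequences in `A`. -/
def TailContinuous (f : Fin n → EllInfty X → X) (A : NonemptyCompacts X) : Prop :=
  ∀ η > 0, ∃ N : ℕ, ∀ j (x y : EllInfty X), (∀ i, x.1 i ∈ A) → (∀ i, y.1 i ∈ A) →
    (∀ i < N, x.1 i = y.1 i) → dist (f j x) (f j y) ≤ η

theorem dist_le_mul_diam {q : ℝ} (hq : 0 < q) (hq1 : q < 1) {N : ℕ} {x y : ℕ → X}
    (hx : ∀ i, x i ∈ A) (hy : ∀ i, y i ∈ A) (hxy : ∀ i < N, x i = y i) (i : ℕ) :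
    q ^ i * dist (x i) (y i) ≤ q ^ N * Metric.diam (A : Set X) := by
  rcases lt_or_ge i N with hi | hi
  · rw [hxy i hi, dist_self, mul_zero]
    positivity
  · exact mul_le_mul (pow_le_pow_of_le_one hq.le hq1.le hi)
      (Metric.dist_le_diam_of_mem A.isCompact.isBounded (hx i) (hy i)) dist_nonneg (by positivity)

theorem exists_nnreal_of_iSup_lipConst_lt_top {ρ : (ℕ → X) → (ℕ → X) → ℝ}
    (h : ⨆ j, lipConst ρ (f j) < ⊤) :
    ∃ K : Fin n → ℝ≥0, ∀ j, ∀ x y : EllInfty X, dist (f j x) (f j y) ≤ K j * ρ x.1 y.1 := by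
  choose K _ hK using fun j => exists_lt_of_lipConst_lt
    ((le_iSup (fun j => lipConst ρ (f j)) j).trans_lt h)
  exact ⟨K, hK⟩

/-- A bound on `ρ` for sequences that agree below `N`, vanishing as `N → ∞`, gives tail
continuity. -/
theorem tailContinuous_of_lipConst {ρ : (ℕ → X) → (ℕ → X) → ℝ}
    (h : ⨆ j, lipConst ρ (f j) < ⊤) {b : ℕ → ℝ} (hb : Filter.Tendsto b Filter.atTop (nhds 0))
    (hρ : ∀ N (x y : ℕ → X), (∀ i, x i ∈ A) → (∀ i, y i ∈ A) → (∀ i < N, x i = y i) →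
      ρ x y ≤ b N) : TailContinuous f A := by
  intro η hη
  obtain ⟨K, hK⟩ := exists_nnreal_of_iSup_lipConst_lt_top h
  have hev : ∀ j, ∀ᶠ N in Filter.atTop, K j * b N < η := fun j => by
    have := hb.const_mul (K j : ℝ)
    rw [mul_zero] at this
    exact this.eventually (gt_mem_nhds hη)
  obtain ⟨N, hN⟩ := (Filter.eventually_all.2 hev).exists
  refine ⟨N, fun j x y hx hy hxy => (hK j x y).trans (le_trans ?_ (hN j).le)⟩
  gcongr
  exact hρ N _ _ hx hy hxy

theorem CondQ.tailContinuous (h : CondQ f) : TailContinuous f A := by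
  obtain ⟨q, hq, hq1, h⟩ := h
  refine tailContinuous_of_lipConst (h.trans ENNReal.one_lt_top)
    (b := fun N => q ^ N * Metric.diam (A : Set X)) ?_ fun N x y hx hy hxy =>
      ciSup_le (dist_le_mul_diam hq hq1 hx hy hxy)
  simpa using (tendsto_pow_atTop_nhds_zero_of_lt_one hq.le hq1).mul_const _

theorem CondP.tailContinuous (h : CondP f) : TailContinuous f A := by
  obtain ⟨p, q, hp, hq, hq1, h⟩ := h
  have hp0 : 0 < p := one_pos.trans_le hp
  set D := Metric.diam (A : Set X)
  have hD : 0 ≤ D := Metric.diam_nonneg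
  have hsum : Summable fun i : ℕ => q ^ i * D ^ p :=
    (summable_geometric_of_lt_one hq.le hq1).mul_right _
  refine tailContinuous_of_lipConst (h.trans ENNReal.ofReal_lt_top)
    (b := fun N => (∑' i, q ^ (i + N) * D ^ p) ^ (1 / p)) ?_ fun N x y hx hy hxy => ?_
  · have := (tendsto_sum_nat_add fun i : ℕ => q ^ i * D ^ p).rpow_const
      (p := 1 / p) (Or.inr (by positivity))
    rwa [Real.zero_rpow (by positivity)] at this
  · have hle : ∀ i, q ^ i * dist (x i) (y i) ^ p ≤ q ^ i * D ^ p := fun i => by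
      gcongr
      exact Metric.dist_le_diam_of_mem A.isCompact.isBounded (hx i) (hy i)
    have hs : Summable fun i => q ^ i * dist (x i) (y i) ^ p :=
      hsum.of_nonneg_of_le (fun i => by positivity) hle
    unfold lpDist
    refine Real.rpow_le_rpow (tsum_nonneg fun i => by positivity) ?_ (by positivity)
    -- The first N terms vanish, leaving a tail of a convergent geometric series.
    rw [← hs.sum_add_tsum_nat_add N, Finset.sum_eq_zero fun i hi => ?_, zero_add]
    · exact ((summable_nat_add_iff N).2 hs).tsum_le_tsum (fun i => hle (i + N))
        ((summable_nat_add_iff N).2 hsum)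
    · rw [hxy i (Finset.mem_range.1 hi), dist_self, Real.zero_rpow hp0.ne', mul_zero]

theorem TailContinuous.exists_dist_extend_le (hf : TailContinuous f A)
    (hL : ContractsUniformly f L) {η : ℝ} (hη : 0 < η) :
    ∃ N : ℕ, ∀ j (x y : ℕ → X) (r : ℝ), (∀ i, x i ∈ A) → (∀ i, y i ∈ A) → 0 ≤ r →
      (∀ i < N, dist (x i) (y i) ≤ r) → dist (extend (f j) x) (extend (f j) y) ≤ L * r + η := by
  obtain ⟨N, hN⟩ := hf η hη
  refine ⟨N, fun j x y r hx hy hr hxy => ?_⟩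
  -- The hybrid separates the two effects: x to z is controlled by uniform contraction, z to y by
  -- tail continuity.
  let z : ℕ → X := fun i => if i < N then y i else x i
  have hz : ∀ i, z i ∈ A := fun i => by
    by_cases hi : i < N
    · simpa [z, hi] using hy i
    · simpa [z, hi] using hx i
  have hxz : dist (extend (f j) x) (extend (f j) z) ≤ L * r :=
    hL.dist_extend_le j hx hz fun i => by
      by_cases hi : i < N
      · simpa [z, hi] using hxy i hi
      · simpa [z, hi] using hr
  have hzy : dist (extend (f j) z) (extend (f j) y) ≤ η := by
    unfold extend
    rw [dif_pos (isBounded_range_of_forall_mem hz), dif_pos (isBounded_range_of_forall_mem hy)]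
    exact hN j _ _ hz hy fun i hi => if_pos hi
  exact (dist_triangle _ _ _).trans (add_le_add hxz hzy)

theorem IsCanonicalMap.exists_agreeBelow_dist_lt (hπ : IsCanonicalMap f A π)
    (hL : ContractsUniformly f L) (hL1 : L < 1) (hA : IsAttractor f A)
    (hf : TailContinuous f A) {ε : ℝ} (hε : 0 < ε) :
    ∃ N k : ℕ, ∀ α β : CodeSpace n, (∀ m ≤ k, AgreeBelow N m (α m) (β m)) →
      dist (π α) (π β) < ε := by
  have hL1' : (L : ℝ) < 1 := by exact_mod_cast hL1
  set D := Metric.diam (A : Set X)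
  have hD : 0 ≤ D := Metric.diam_nonneg
  -- With this error, ε/2 is the fixed point of r ↦ L r + (1 - L) ε/2, so the errors do not
  -- accumulate and one N serves all depths k.
  obtain ⟨N, hN⟩ := hf.exists_dist_extend_le hL
    (show 0 < (1 - L) * (ε / 2) from mul_pos (sub_pos.2 hL1') (half_pos hε))
  have hbound : ∀ (k : ℕ) (α β : CodeSpace n), (∀ m ≤ k, AgreeBelow N m (α m) (β m)) →
      dist (π α) (π β) ≤ L ^ (k + 1) * D + ε / 2 := by
    intro k
    induction k with
    | zero =>
      intro α β h
      have h0 : β.restrict 0 = α.restrict 0 := funext fun i => by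
        obtain rfl : i = 0 := Fin.fin_one_eq_zero i
        exact (h 0 le_rfl).symm
      exact (hL.dist_le_of_mem_piece hA (hπ.mem_piece α 0) (h0 ▸ hπ.mem_piece β 0)).trans
        (le_add_of_nonneg_right (half_pos hε).le)
    | succ k ih =>
      intro α β h
      have h0 : α 0 = β 0 := h 0 (Nat.zero_le _)
      rw [hπ.apply_eq_extend hL hL1 hA α, hπ.apply_eq_extend hL hL1 hA β, ← h0]
      refine (hN (α 0) _ _ (L ^ (k + 1) * D + ε / 2) (fun i => hπ.apply_mem hA _)
        (fun i => hπ.apply_mem hA _) (by positivity) fun i hi => ih _ _ fun m hm =>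
          h (m + 1) (Nat.succ_le_succ hm) i hi).trans (le_of_eq ?_)
      ring
  obtain ⟨k, hk⟩ := ((tendsto_pow_succ_mul hL1 D).eventually
    (gt_mem_nhds (half_pos hε))).exists
  exact ⟨N, k, fun α β h => (hbound k α β h).trans_lt (by linarith)⟩

/-- It suffices that small distances force agreement in any finite set of positions. -/
theorem IsCanonicalMap.continuousForDist (hπ : IsCanonicalMap f A π)
    (hL : ContractsUniformly f L) (hL1 : L < 1) (hA : IsAttractor f A)
    (hf : TailContinuous f A) {ρ : CodeSpace n → CodeSpace n → ℝ}
    (hρ : ∀ N m : ℕ, ∃ δ > 0, ∀ α β, ρ α β < δ → AgreeBelow N m (α m) (β m)) :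
    ContinuousForDist ρ π := by
  intro α ε hε
  obtain ⟨N, k, h⟩ := hπ.exists_agreeBelow_dist_lt hL hL1 hA hf hε
  choose δ hδ hagree using hρ N
  have hne : (Finset.range (k + 1)).Nonempty := ⟨0, by simp⟩
  refine ⟨(Finset.range (k + 1)).inf' hne δ, (Finset.lt_inf'_iff hne).2 fun m _ => hδ m,
    fun β hβ => h α β fun m hm => hagree m α β (hβ.trans_le (Finset.inf'_le _ ?_))⟩
  simpa [Nat.lt_succ_iff] using hm

end TailContinuity

/-! ### Small code distance forces agreement at finitely many positions. -/

section CodeDistances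

variable {n : ℕ} {p q : ℝ}

theorem discreteDist_nonneg (i j : Fin n) : 0 ≤ discreteDist i j := by
  unfold discreteDist
  split_ifs <;> norm_num

theorem discreteDist_le_one (i j : Fin n) : discreteDist i j ≤ 1 := by
  unfold discreteDist
  split_ifs <;> norm_num

theorem eq_of_discreteDist_lt_one {i j : Fin n} (h : discreteDist i j < 1) : i = j := by
  by_contra hij
  simp [discreteDist, hij] at h

/-- Boundedness is what lets each supremum dominate its terms; an unbounded real `⨆` would default
to 0. -/
theorem nestedDistS_mem_Icc (hq : 0 < q) (hq1 : q < 1) :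
    ∀ (k : ℕ) (x y : Nested (Fin n) k), nestedDistS q k x y ∈ Icc (0 : ℝ) 1
  | 0, x, y => ⟨discreteDist_nonneg x y, discreteDist_le_one x y⟩
  | k + 1, x, y => by
    have h := nestedDistS_mem_Icc hq hq1 k
    exact ⟨Real.iSup_nonneg fun i => mul_nonneg (by positivity) (h _ _).1,
      ciSup_le fun i => mul_le_one₀ (pow_le_one₀ hq.le hq1.le) (h _ _).1 (h _ _).2⟩

theorem pow_mul_le_iSup (hq : 0 < q) (hq1 : q < 1) {u : ℕ → ℝ} (hu : ∀ i, u i ∈ Icc (0 : ℝ) 1)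
    (i : ℕ) : q ^ i * u i ≤ ⨆ i, q ^ i * u i :=
  le_ciSup (f := fun i => q ^ i * u i) ⟨1, by
    rintro _ ⟨i, rfl⟩
    exact mul_le_one₀ (pow_le_one₀ hq.le hq1.le) (hu i).1 (hu i).2⟩ i

theorem exists_nestedDistS_lt_imp_agreeBelow (hq : 0 < q) (hq1 : q < 1) (N : ℕ) :
    ∀ m : ℕ, ∃ δ > 0, ∀ x y : Nested (Fin n) m, nestedDistS q m x y < δ → AgreeBelow N m x y
  | 0 => ⟨1, one_pos, fun _ _ h => eq_of_discreteDist_lt_one h⟩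
  | m + 1 => by
    obtain ⟨δ, hδ, h⟩ := exists_nestedDistS_lt_imp_agreeBelow hq hq1 N m
    -- Positions i < N carry weight at least q^N.
    refine ⟨q ^ N * δ, by positivity, fun x y hxy i hi => h _ _ ?_⟩
    have h1 : q ^ i * nestedDistS q m (x i) (y i) < q ^ N * δ :=
      (pow_mul_le_iSup hq hq1 (fun i => nestedDistS_mem_Icc hq hq1 m (x i) (y i)) i).trans_lt hxy
    have h2 : q ^ N * δ ≤ q ^ i * δ :=
      mul_le_mul_of_nonneg_right (pow_le_pow_of_le_one hq.le hq1.le hi.le) hδ.le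
    exact lt_of_mul_lt_mul_left (h1.trans_le h2) (by positivity)

theorem exists_codeDistS_lt_imp_agreeBelow (hq : 0 < q) (hq1 : q < 1) (N m : ℕ) :
    ∃ δ > 0, ∀ α β : CodeSpace n, codeDistS q α β < δ → AgreeBelow N m (α m) (β m) := by
  obtain ⟨δ, hδ, h⟩ := exists_nestedDistS_lt_imp_agreeBelow (n := n) hq hq1 N m
  refine ⟨q ^ m * δ, by positivity, fun α β hαβ => h _ _ ?_⟩
  exact lt_of_mul_lt_mul_left ((pow_mul_le_iSup hq hq1
    (fun k => nestedDistS_mem_Icc hq hq1 k (α k) (β k)) m).trans_lt hαβ) (by positivity)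

theorem nestedDistP_nonneg (hq : 0 < q) :
    ∀ (k : ℕ) (x y : Nested (Fin n) k), 0 ≤ nestedDistP p q k x y
  | 0, x, y => discreteDist_nonneg x y
  | k + 1, x, y => Real.rpow_nonneg (tsum_nonneg fun i => mul_nonneg (by positivity)
      (Real.rpow_nonneg (nestedDistP_nonneg hq k _ _) _)) _

theorem nestedDistP_succ_rpow (hp : 1 ≤ p) (hq : 0 < q) (k : ℕ) (x y : Nested (Fin n) (k + 1)) :
    nestedDistP p q (k + 1) x y ^ p = ∑' i : ℕ, q ^ i * nestedDistP p q k (x i) (y i) ^ p := by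
  have hs : 0 ≤ ∑' i : ℕ, q ^ i * nestedDistP p q k (x i) (y i) ^ p :=
    tsum_nonneg fun i => mul_nonneg (by positivity)
      (Real.rpow_nonneg (nestedDistP_nonneg hq k _ _) _)
  have h := Real.rpow_inv_rpow hs (one_pos.trans_le hp).ne'
  rwa [← one_div] at h

theorem summable_pow_mul_of_le (hq : 0 < q) (hq1 : q < 1) {u : ℕ → ℝ} {M : ℝ}
    (hu : ∀ i, 0 ≤ u i) (hM : ∀ i, u i ≤ M) : Summable fun i => q ^ i * u i :=
  ((summable_geometric_of_lt_one hq.le hq1).mul_right M).of_nonneg_of_le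
    (fun i => mul_nonneg (by positivity) (hu i))
    fun i => mul_le_mul_of_nonneg_left (hM i) (by positivity)

/-- Each level sums the weights q^i and so costs a factor 1/(1 - q); the weights ((1 - q)/2)^k of
`codeDistP` compensate for this growth. -/
theorem nestedDistP_rpow_le (hp : 1 ≤ p) (hq : 0 < q) (hq1 : q < 1) :
    ∀ (k : ℕ) (x y : Nested (Fin n) k), nestedDistP p q k x y ^ p ≤ ((1 - q)⁻¹) ^ k
  | 0, x, y => by
    rw [pow_zero]
    exact Real.rpow_le_one (discreteDist_nonneg x y) (discreteDist_le_one x y)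
      (one_pos.trans_le hp).le
  | k + 1, x, y => by
    have h := nestedDistP_rpow_le hp hq hq1 k
    have hgeom := summable_geometric_of_lt_one hq.le hq1
    rw [nestedDistP_succ_rpow hp hq, pow_succ', ← tsum_geometric_of_lt_one hq.le hq1,
      ← tsum_mul_right]
    refine (summable_pow_mul_of_le hq hq1
      (fun i => Real.rpow_nonneg (nestedDistP_nonneg hq k _ _) _) fun i => h _ _).tsum_le_tsum
      (fun i => ?_) (hgeom.mul_right _)
    rw [tsum_geometric_of_lt_one hq.le hq1]
    exact mul_le_mul_of_nonneg_left (h _ _) (by positivity)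

theorem exists_nestedDistP_rpow_lt_imp_agreeBelow (hp : 1 ≤ p) (hq : 0 < q) (hq1 : q < 1)
    (N : ℕ) : ∀ m : ℕ, ∃ δ > 0, ∀ x y : Nested (Fin n) m,
      nestedDistP p q m x y ^ p < δ → AgreeBelow N m x y
  | 0 => ⟨1, one_pos, fun x y h => eq_of_discreteDist_lt_one <| lt_of_not_ge fun h1 =>
      h.not_ge (Real.one_le_rpow h1 (one_pos.trans_le hp).le)⟩
  | m + 1 => by
    obtain ⟨δ, hδ, h⟩ := exists_nestedDistP_rpow_lt_imp_agreeBelow hp hq hq1 N m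
    refine ⟨q ^ N * δ, by positivity, fun x y hxy i hi => h _ _ ?_⟩
    rw [nestedDistP_succ_rpow hp hq] at hxy
    have h0 : ∀ i, 0 ≤ nestedDistP p q m (x i) (y i) ^ p := fun i =>
      Real.rpow_nonneg (nestedDistP_nonneg hq m _ _) _
    have h1 : q ^ i * nestedDistP p q m (x i) (y i) ^ p < q ^ N * δ :=
      ((summable_pow_mul_of_le hq hq1 h0 fun i => nestedDistP_rpow_le hp hq hq1 m _ _).le_tsum i
        fun j _ => mul_nonneg (by positivity) (h0 j)).trans_lt hxy
    have h2 : q ^ N * δ ≤ q ^ i * δ :=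
      mul_le_mul_of_nonneg_right (pow_le_pow_of_le_one hq.le hq1.le hi.le) hδ.le
    exact lt_of_mul_lt_mul_left (h1.trans_le h2) (by positivity)

theorem exists_codeDistP_lt_imp_agreeBelow (hp : 1 ≤ p) (hq : 0 < q) (hq1 : q < 1) (N m : ℕ) :
    ∃ δ > 0, ∀ α β : CodeSpace n, codeDistP p q α β < δ → AgreeBelow N m (α m) (β m) := by
  obtain ⟨δ, hδ, h⟩ := exists_nestedDistP_rpow_lt_imp_agreeBelow (n := n) hp hq hq1 N m
  have hp0 : 0 < p := one_pos.trans_le hp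
  have hq2 : 0 < 1 - q := sub_pos.2 hq1
  refine ⟨(((1 - q) / 2) ^ m * δ) ^ (1 / p), by positivity, fun α β hαβ => h _ _ ?_⟩
  have h0 : ∀ k, 0 ≤ ((1 - q) / 2) ^ k * nestedDistP p q k (α k) (β k) ^ p := fun k =>
    mul_nonneg (by positivity) (Real.rpow_nonneg (nestedDistP_nonneg hq k _ _) _)
  -- Summability is essential: a divergent `tsum` would be 0 and bound no term.
  have hs : Summable fun k => ((1 - q) / 2) ^ k * nestedDistP p q k (α k) (β k) ^ p := by
    refine summable_geometric_two.of_nonneg_of_le h0 fun k => ?_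
    calc ((1 - q) / 2) ^ k * nestedDistP p q k (α k) (β k) ^ p
        ≤ ((1 - q) / 2) ^ k * ((1 - q)⁻¹) ^ k :=
          mul_le_mul_of_nonneg_left (nestedDistP_rpow_le hp hq hq1 k _ _) (by positivity)
      _ = (1 / 2) ^ k := by
          rw [← mul_pow]
          congr 1
          field_simp
  have h1 := (Real.rpow_lt_rpow_iff (tsum_nonneg h0) (by positivity) (by positivity)).1 hαβ
  exact lt_of_mul_lt_mul_left ((hs.le_tsum m fun j _ => h0 j).trans_lt h1) (by positivity)

end CodeDistances

end

theorem theorem5p8 {X : Type*} [MetricSpace X] [CompleteSpace X] [Nonempty X]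
    (n : ℕ) (hn : 0 < n) (f : Fin n → EllInfty X → X) (hS1 : CondS1 f) :
    (∃! A : NonemptyCompacts X, IsAttractor f A) ∧
    ∀ A : NonemptyCompacts X, IsAttractor f A →
      ∃ π : CodeSpace n → X, IsCanonicalMap f A π ∧
        closure (range π) = A ∧
        (CondS2 f → range π = A) ∧
        @Continuous (CodeSpace n) X (discreteProductTopology n) _ π ∧
        (CondQ f ∨ CondP f →
          (∀ q : ℝ, 0 < q → q < 1 → ContinuousForDist (codeDistS q) π) ∧
          (∀ p q : ℝ, 1 ≤ p → 0 < q → q < 1 → ContinuousForDist (codeDistP p q) π)) := by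
  obtain ⟨L, hL1, hL⟩ := exists_contractsUniformly hS1.1
  refine ⟨hL.existsUnique_isAttractor hL1 hn hS1.2, fun A hA => ?_⟩
  obtain ⟨π, hπ⟩ := hL.exists_isCanonicalMap hL1 hA
  refine ⟨π, hπ, hπ.closure_range hL hL1 hA hn hS1.2, fun hS2 => hπ.range_eq hA hS2.2,
    hπ.continuous hL hL1 hA, fun h => ?_⟩
  have hf : TailContinuous f A := h.elim CondQ.tailContinuous CondP.tailContinuous
  exact ⟨fun q hq hq1 => hπ.continuousForDist hL hL1 hA hf
      (exists_codeDistS_lt_imp_agreeBelow hq hq1),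
    fun p q hp hq hq1 => hπ.continuousForDist hL hL1 hA hf
      (exists_codeDistP_lt_imp_agreeBelow hp hq hq1)⟩
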